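/- Let $(\mathcal X,\mathcal A,P)$ be a probability space, write $P(g)=\int g\,dP$, let $f\in L_2(P)$, and let $h_1,\dots,h_m\in L_2(P)$ be control variates with $P(h_k)=0$ for all $k$; put $h=(h_1,\dots,h_m)^T$. Let $$\beta^\star\in\arg\min_{\beta\in\mathbb R^m}P\bigl[(f-P(f)-\beta^Th)^2\bigr],\qquad S^\star=\operatorname{supp}(\beta^\star)=\{j:\beta^\star_j\neq0\},\qquad \ell^\star=|S^\star|\ge1 .$$ Assume: (i) (sub-Gaussian residuals) for some $\tau>0$, the function $\epsilon=f-P(f)-\beta^{\star T}h$ satisfies $\int e^{t\epsilon}\,dP\le e^{t^2\tau^2/2}$ for all $t\in\mathbb R$; (ii) (bounded control variates) $h_1,\dots,h_m$ are uniformly bounded; put $U_h=\max_{j}\sup_{x\in\mathcal X}|h_j(x)|$; (iii) the active control variates $h_k$, $k\in S^\star$, are linearly independent in $L_2(P)$, so that the smallest eigenvalue $\gamma^{\star\star}$ of the $\ell^\star\times\ell^\star$ Gram matrix $G_{S^\star}=(P(h_jh_k))_{j,k\in S^\star}$ is positive; (iv) (orthogonality) $P(h_jh_k)=0$ for all $j\in\{1,\dots,m\}\setminus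 S^\star$ and $k\in S^\star$. Let $\delta\in(0,1)$, let the integer $n$ satisfy $$n\ge70\,\bigl(\ell^\star U_h^2/\gamma^{\star\star}\bigr)^2\log(10\,\ell^\star m/\delta),$$ and let $\lambda$ satisfy $$13\,U_h\sqrt{\log(10m/\delta)}\,\frac{\tau}{\sqrt n}\le\lambda\le\frac{\gamma^{\star\star}}{3\sqrt{\ell^\star}}\min_{k\in S^\star}|\beta^\star_k| .$$ Let $X_1,\dots,X_n$ be independent random variables with common distribution $P$. Then, with probability at least $1-\delta$, the coefficient part $\hat\beta$ of a minimizer $$(\hat\alpha,\hat\beta)\in\arg\min_{(\alpha,\beta)\in\mathbb R\times\mathbb R^m}\ \frac1{2n}\sum_{i=1}^n\bigl(f(X_i)-\alpha-\beta^Th(X_i)\bigr)^2+\lambda\sum_{j=1}^m|\beta_j|$$ (the LASSO solution) exists and is unique, and $\operatorname{supp}(\hat\beta)=S^\star$. -/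

import Mathlib

open MeasureTheory ProbabilityTheory
open scoped NNReal ENNReal Matrix

noncomputable section

namespace ControlVariates

variable {𝒳 : Type*} [MeasurableSpace 𝒳] {m n : ℕ}

/-- The linear combination of the control functions with coefficient vector `β`. -/
def linComb (h : Fin m → 𝒳 → ℝ) (β : Fin m → ℝ) (x : 𝒳) : ℝ :=
  ∑ j, β j * h j x

/-- `β` is an oracle coefficient: it minimizes the `P`-expectation of
`(f - P(f) - βᵀh)²` over all coefficient vectors. -/
def IsOracleCoef (P : Measure 𝒳) (f : 𝒳 → ℝ) (h : Fin m → 𝒳 → ℝ) (β : Fin m → ℝ) : Prop :=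
  ∀ b : Fin m → ℝ,
    ∫ x, (f x - (∫ y, f y ∂P) - linComb h β x) ^ 2 ∂P
      ≤ ∫ x, (f x - (∫ y, f y ∂P) - linComb h b x) ^ 2 ∂P

/-- The residual function `f - P(f) - βᵀh`. -/
def residual (P : Measure 𝒳) (f : 𝒳 → ℝ) (h : Fin m → 𝒳 → ℝ) (β : Fin m → ℝ) (x : 𝒳) : ℝ :=
  f x - (∫ y, f y ∂P) - linComb h β x

/-- The active set (support) of a coefficient vector. -/
def activeSet (β : Fin m → ℝ) : Finset (Fin m) :=
  Finset.univ.filter fun j => β j ≠ 0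

/-- The largest of the suprema of the functions `|h j|`
(meaningful when the `h j` are uniformly bounded). -/
def supBound (h : Fin m → 𝒳 → ℝ) : ℝ :=
  ⨆ j, ⨆ x, |h j x|

/-- The Gram matrix in `L²(P)` of the control functions with index in `S`. -/
def gram (P : Measure 𝒳) (h : Fin m → 𝒳 → ℝ) (S : Finset (Fin m)) : Matrix S S ℝ :=
  Matrix.of fun j k => ∫ x, h j x * h k x ∂P

/-- The smallest eigenvalue of a real (symmetric) matrix. -/
def lambdaMin {ι : Type*} [Fintype ι] [DecidableEq ι] (A : Matrix ι ι ℝ) : ℝ :=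
  sInf {μ : ℝ | Module.End.HasEigenvalue (Matrix.toLin' A) μ}

/-- The penalized least-squares criterion
`(2n)⁻¹ ‖y - a 𝟙 - H b‖₂² + lam ‖b‖₁`. -/
def lassoObjective (y : Fin n → ℝ) (H : Matrix (Fin n) (Fin m) ℝ) (lam : ℝ)
    (a : ℝ) (b : Fin m → ℝ) : ℝ :=
  1 / (2 * (n : ℝ)) * ∑ i, (y i - a - (H *ᵥ b) i) ^ 2 + lam * ∑ j, |b j|

/-- `b` is a LASSO coefficient vector: for some intercept `a` the pair `(a, b)` is a global
minimizer of the LASSO criterion. -/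
def IsLassoCoef (y : Fin n → ℝ) (H : Matrix (Fin n) (Fin m) ℝ) (lam : ℝ)
    (b : Fin m → ℝ) : Prop :=
  ∃ a : ℝ, ∀ (a' : ℝ) (b' : Fin m → ℝ),
    lassoObjective y H lam a b ≤ lassoObjective y H lam a' b'

end ControlVariates

end

/-! The proof is the primal-dual witness method, run on an event of high probability. Let `C` be the
matrix of sample covariances of the control variates and `w` the vector of their sample covariances
with the residual `ε`; centering accounts for the intercept. The candidate is `b = β + v`, where `v`
is supported on the active set `S` and solves `C v = w - λ sign β` on the rows in `S`. Its
multiplier `z` is `sign β` on `S` and `(w - C v) / λ` off `S`, so stationarity holds by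
construction. If `|v j| < |β j|` on `S`, then `b` has the signs and the support of `β`. If moreover
`|z j| < 1` off `S` and the centered active design is injective, `isLassoCoef_iff_eq_of_kkt` makes
`b` the only LASSO coefficient vector.

By `lasso_support_recovery_of_sampleCov` it suffices that `C` is coercive on `S` with constant `4/5
γ`, that its cross entries are at most `γ / (5ℓ)`, and that `|w j| ≤ λ/2`. All three perturb
population facts: the Rayleigh bound for the Gram matrix, the orthogonality of inactive to active
variates, and `P(h j * ε) = 0`, which is the first-order condition for the oracle.

The perturbations are controlled by Chernoff bounds. Averages of `h j * h k`, `h j` and `ε` are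
sub-Gaussian. The product `h j * ε` is a bounded function times a sub-Gaussian one, and
`integral_exp_mul_mul_le` bounds its moment generating function near the origin; the sample size
condition keeps the Chernoff parameter in that range. A union bound over the four families finishes.
-/

namespace ControlVariates

/-! ### Optimality conditions for the LASSO -/

/-- Expanding the square about a stationary point, the linear term is `-λ ∑ z j * (b' j - b j)` and
merges with the change of penalty. When `|z j| ≤ 1` both excess terms are nonnegative, so minimality
and its equality case can be read off. -/
theorem lassoObjective_sub {m n : ℕ} (y : Fin n → ℝ) (H : Matrix (Fin n) (Fin m) ℝ)
    (lam : ℝ) (hn : 0 < n) (a : ℝ) (b z : Fin m → ℝ)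
    (hr0 : ∑ i, (y i - a - (H *ᵥ b) i) = 0)
    (hgrad : ∀ j, ∑ i, H i j * (y i - a - (H *ᵥ b) i) = n * (lam * z j))
    (hzb : ∀ j, z j * b j = |b j|) (a' : ℝ) (b' : Fin m → ℝ) :
    lassoObjective y H lam a' b' = lassoObjective y H lam a b
      + 1 / (2 * (n : ℝ)) * ∑ i, (a' - a + (H *ᵥ (b' - b)) i) ^ 2
      + lam * ∑ j, (|b' j| - z j * b' j) := by
  have hn' : (n : ℝ) ≠ 0 := by positivity
  set r : Fin n → ℝ := fun i => y i - a - (H *ᵥ b) i with hr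
  set d : Fin n → ℝ := fun i => a' - a + (H *ᵥ (b' - b)) i with hd
  have h1 : ∀ i, y i - a' - (H *ᵥ b') i = r i - d i := by
    intro i; simp only [hr, hd, Matrix.mulVec_sub, Pi.sub_apply]; ring
  have h2 : ∑ i, r i * d i = n * lam * ∑ j, z j * (b' j - b j) := by
    have e1 : ∑ i, r i * (H *ᵥ (b' - b)) i = ∑ j, (b' j - b j) * ∑ i, H i j * r i := by
      simp only [Matrix.mulVec, dotProduct, Finset.mul_sum, Pi.sub_apply]
      rw [Finset.sum_comm]
      exact Finset.sum_congr rfl fun j _ => Finset.sum_congr rfl fun i _ => by ring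
    have e2 : ∑ i, r i * d i = (a' - a) * ∑ i, r i + ∑ i, r i * (H *ᵥ (b' - b)) i := by
      rw [Finset.mul_sum, ← Finset.sum_add_distrib]
      exact Finset.sum_congr rfl fun i _ => by simp only [hd]; ring
    rw [e2, hr0, e1, Finset.mul_sum, mul_zero, zero_add]
    exact Finset.sum_congr rfl fun j _ => by rw [hgrad]; ring
  have h3 : ∑ i, (r i - d i) ^ 2
      = ∑ i, (r i) ^ 2 + ∑ i, (d i) ^ 2 - 2 * ∑ i, r i * d i := by
    rw [Finset.mul_sum, ← Finset.sum_add_distrib, ← Finset.sum_sub_distrib]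
    exact Finset.sum_congr rfl fun i _ => by ring
  have h4 : ∑ j, z j * (b' j - b j) = ∑ j, z j * b' j - ∑ j, |b j| := by
    rw [← Finset.sum_sub_distrib]
    exact Finset.sum_congr rfl fun j _ => by rw [← hzb]; ring
  unfold lassoObjective
  simp only [h1]
  change _ = 1 / (2 * (n : ℝ)) * ∑ i, (r i) ^ 2 + _ + _ + _
  rw [h3, h2, h4, Finset.sum_sub_distrib]
  field_simp
  ring

/-- Strict dual feasibility together with injectivity of the centered active design makes the
LASSO coefficient vector unique. -/
theorem isLassoCoef_iff_eq_of_kkt {m n : ℕ} (y : Fin n → ℝ) (H : Matrix (Fin n) (Fin m) ℝ)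
    (lam : ℝ) (hn : 0 < n) (hlam : 0 < lam) (S : Finset (Fin m)) (a : ℝ) (b z : Fin m → ℝ)
    (hr0 : ∑ i, (y i - a - (H *ᵥ b) i) = 0)
    (hgrad : ∀ j, ∑ i, H i j * (y i - a - (H *ᵥ b) i) = n * (lam * z j))
    (hz : ∀ j, |z j| ≤ 1) (hzb : ∀ j, z j * b j = |b j|) (hzS : ∀ j ∉ S, |z j| < 1)
    (hinj : ∀ (c : ℝ) (v : Fin m → ℝ), (∀ j ∉ S, v j = 0) →
      (∀ i, c + (H *ᵥ v) i = 0) → v = 0) (b' : Fin m → ℝ) :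
    IsLassoCoef y H lam b' ↔ b' = b := by
  have hkey := lassoObjective_sub y H lam hn a b z hr0 hgrad hzb
  have hpos : ∀ x : Fin m → ℝ, ∀ j, 0 ≤ |x j| - z j * x j := by
    intro x j
    have : z j * x j ≤ |x j| := by
      calc z j * x j ≤ |z j * x j| := le_abs_self _
        _ = |z j| * |x j| := abs_mul _ _
        _ ≤ 1 * |x j| := by gcongr; exact hz j
        _ = |x j| := one_mul _
    linarith
  have hzero : ∀ x : Fin m → ℝ, (∀ j, |x j| - z j * x j = 0) → ∀ j ∉ S, x j = 0 := by
    intro x hx j hj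
    by_contra h0
    have : |x j| < |x j| := by
      calc |x j| = z j * x j := by linarith [hx j]
        _ ≤ |z j| * |x j| := by rw [← abs_mul]; exact le_abs_self _
        _ < 1 * |x j| := by
          have := abs_pos.2 h0
          gcongr
          exact hzS j hj
        _ = |x j| := one_mul _
    exact lt_irrefl _ this
  have hn' : (0 : ℝ) < n := by positivity
  have hmin : ∀ a' b'', lassoObjective y H lam a b ≤ lassoObjective y H lam a' b'' := by
    intro a' b''
    rw [hkey a' b'']
    have h1 : 0 ≤ 1 / (2 * (n : ℝ)) * ∑ i, (a' - a + (H *ᵥ (b'' - b)) i) ^ 2 :=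
      mul_nonneg (by positivity) (Finset.sum_nonneg fun i _ => sq_nonneg _)
    have h2 : 0 ≤ lam * ∑ j, (|b'' j| - z j * b'' j) :=
      mul_nonneg hlam.le (Finset.sum_nonneg fun j _ => hpos _ j)
    linarith
  constructor
  · rintro ⟨a', ha'⟩
    -- Another minimizer makes both excess terms vanish: the penalty gap forces its support into
    -- `S`, the quadratic one makes the two fits equal.
    have hle := ha' a b
    rw [hkey a' b'] at hle
    have h1 : 0 ≤ ∑ i, (a' - a + (H *ᵥ (b' - b)) i) ^ 2 :=
      Finset.sum_nonneg fun i _ => sq_nonneg _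
    have h2 : 0 ≤ ∑ j, (|b' j| - z j * b' j) := Finset.sum_nonneg fun j _ => hpos _ j
    have hc : 0 < 1 / (2 * (n : ℝ)) := by positivity
    have h1' := mul_nonneg hc.le h1
    have h2' := mul_nonneg hlam.le h2
    have e1 : ∑ i, (a' - a + (H *ᵥ (b' - b)) i) ^ 2 = 0 := by
      rcases mul_eq_zero.1 (le_antisymm (by linarith) h1') with h | h
      · exact absurd h hc.ne'
      · exact h
    have e2 : ∑ j, (|b' j| - z j * b' j) = 0 := by
      rcases mul_eq_zero.1 (le_antisymm (by linarith) h2') with h | h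
      · exact absurd h hlam.ne'
      · exact h
    rw [Finset.sum_eq_zero_iff_of_nonneg fun i _ => sq_nonneg _] at e1
    rw [Finset.sum_eq_zero_iff_of_nonneg fun j _ => hpos _ j] at e2
    have hb0 := hzero b fun j => by rw [hzb]; ring
    have hb0' := hzero b' fun j => e2 j (Finset.mem_univ _)
    have := hinj (a' - a) (b' - b) (fun j hj => by simp [hb0 j hj, hb0' j hj])
      fun i => by simpa using e1 i (Finset.mem_univ _)
    exact sub_eq_zero.1 this
  · rintro rfl
    exact ⟨a, hmin⟩

/-- A linear system whose matrix is coercive on the vectors supported on `S` is solvable there. -/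
theorem exists_supported_solution {m : ℕ} (S : Finset (Fin m)) (A : Fin m → Fin m → ℝ) {κ : ℝ}
    (hκ : 0 < κ)
    (hA : ∀ v : Fin m → ℝ, (∀ j ∉ S, v j = 0) →
      κ * ∑ j, v j ^ 2 ≤ ∑ j, v j * ∑ k, A j k * v k) (c : Fin m → ℝ) :
    ∃ v : Fin m → ℝ, (∀ j ∉ S, v j = 0) ∧ ∀ j ∈ S, ∑ k, A j k * v k = c j := by
  -- Rows outside `S` are replaced by those of the identity, so the restricted system becomes a
  -- square one on the whole space, and injectivity gives solvability.
  let T : (Fin m → ℝ) →ₗ[ℝ] (Fin m → ℝ) :=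
    Matrix.mulVecLin (Matrix.of fun j k => if j ∈ S then A j k else if j = k then 1 else 0)
  have hT1 : ∀ v, ∀ j ∈ S, T v j = ∑ k, A j k * v k := by
    intro v j hj
    simp [T, Matrix.mulVec, dotProduct, hj]
  have hT2 : ∀ v, ∀ j ∉ S, T v j = v j := by
    intro v j hj
    simp [T, Matrix.mulVec, dotProduct, hj]
  have hinj : Function.Injective T := by
    rw [injective_iff_map_eq_zero]
    intro v hv
    have hoff : ∀ j ∉ S, v j = 0 := fun j hj => by rw [← hT2 v j hj, hv]; rfl
    have hle := hA v hoff
    have h0 : ∑ j, v j * ∑ k, A j k * v k = 0 := by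
      refine Finset.sum_eq_zero fun j _ => ?_
      by_cases hj : j ∈ S
      · rw [← hT1 v j hj, hv]; simp
      · rw [hoff j hj, zero_mul]
    rw [h0] at hle
    have h1 : 0 ≤ ∑ j, v j ^ 2 := Finset.sum_nonneg fun j _ => sq_nonneg _
    have h2 : ∑ j, v j ^ 2 = 0 := le_antisymm (by nlinarith) h1
    rw [Finset.sum_eq_zero_iff_of_nonneg fun i _ => sq_nonneg _] at h2
    funext j
    simpa using h2 j (Finset.mem_univ _)
  obtain ⟨v, hv⟩ := (LinearMap.injective_iff_surjective.1 hinj) (fun j => if j ∈ S then c j else 0)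
  refine ⟨v, fun j hj => ?_, fun j hj => ?_⟩
  · rw [← hT2 v j hj, hv]; simp [hj]
  · rw [← hT1 v j hj, hv]; simp [hj]

/-! ### Sample covariances -/

/-- The arithmetic mean of a finite sample. -/
noncomputable def sampleMean {n : ℕ} (x : Fin n → ℝ) : ℝ := (∑ i, x i) / n

/-- The empirical covariance of two finite samples. -/
noncomputable def sampleCov {n : ℕ} (x y : Fin n → ℝ) : ℝ := (∑ i, x i * (y i - sampleMean y)) / n

theorem sampleCov_eq {n : ℕ} (x y : Fin n → ℝ) :
    sampleCov x y = sampleMean (fun i => x i * y i) - sampleMean x * sampleMean y := by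
  simp only [sampleCov, sampleMean, mul_sub, Finset.sum_sub_distrib, ← Finset.sum_mul]
  ring

theorem sum_sub_sampleMean {n : ℕ} (hn : 0 < n) (x : Fin n → ℝ) :
    ∑ i, (x i - sampleMean x) = 0 := by
  have hn' : (n : ℝ) ≠ 0 := by positivity
  simp only [sampleMean, Finset.sum_sub_distrib, Finset.sum_const, Finset.card_univ,
    Fintype.card_fin, nsmul_eq_mul]
  field_simp
  ring

theorem sampleMean_mulVec {m n : ℕ} (H : Matrix (Fin n) (Fin m) ℝ) (v : Fin m → ℝ) :
    sampleMean (H *ᵥ v) = ∑ k, sampleMean (fun i => H i k) * v k := by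
  simp only [sampleMean, Matrix.mulVec, dotProduct]
  rw [Finset.sum_comm, Finset.sum_div]
  exact Finset.sum_congr rfl fun k _ => by rw [← Finset.sum_mul]; ring

theorem sampleCov_mulVec {m n : ℕ} (x : Fin n → ℝ) (H : Matrix (Fin n) (Fin m) ℝ)
    (v : Fin m → ℝ) :
    sampleCov x (H *ᵥ v) = ∑ k, sampleCov x (fun i => H i k) * v k := by
  simp only [sampleCov_eq, sub_mul, Finset.sum_sub_distrib, sampleMean_mulVec, Finset.mul_sum]
  congr 1
  · simp only [sampleMean, Matrix.mulVec, dotProduct, Finset.mul_sum]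
    rw [Finset.sum_comm, Finset.sum_div]
    refine Finset.sum_congr rfl fun k _ => ?_
    rw [div_mul_eq_mul_div, Finset.sum_mul]
    exact congrArg (· / (n : ℝ)) (Finset.sum_congr rfl fun i _ => by ring)
  · exact Finset.sum_congr rfl fun k _ => by ring

theorem sign_mul_add_eq_abs {x d : ℝ} (h : |d| < |x|) :
    (SignType.sign x : ℝ) * (x + d) = |x + d| := by
  have hd := abs_lt.1 h
  rcases lt_trichotomy x 0 with hx | hx | hx
  · rw [abs_of_neg hx] at hd
    rw [abs_of_neg (by linarith), sign_neg hx]; simp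
  · subst hx; simp only [abs_zero] at h; exact absurd h (not_lt.2 (abs_nonneg _))
  · rw [abs_of_pos hx] at hd
    rw [abs_of_pos (by linarith), sign_pos hx]; simp

theorem abs_sign_le_one (x : ℝ) : |(SignType.sign x : ℝ)| ≤ 1 := by
  rcases lt_trichotomy x 0 with hx | hx | hx <;> simp [hx]

theorem sq_sum_abs_le_card_mul {m : ℕ} (S : Finset (Fin m)) (v : Fin m → ℝ)
    (hv : ∀ j ∉ S, v j = 0) :
    (∑ j, |v j|) ^ 2 ≤ (S.card : ℝ) * ∑ j, v j ^ 2 := by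
  have e1 : ∑ j, |v j| = ∑ j ∈ S, |v j| :=
    (Finset.sum_subset (Finset.subset_univ S) fun j _ hj => by simp [hv j hj]).symm
  have e2 : ∑ j, v j ^ 2 = ∑ j ∈ S, |v j| ^ 2 := by
    rw [← Finset.sum_subset (Finset.subset_univ S) fun j _ hj => by simp [hv j hj]]
    simp
  rw [e1, e2]
  exact sq_sum_le_card_mul_sum_sq

/-! ### The primal-dual witness -/

/-- Support recovery for the LASSO with intercept, from bounds on the sample covariances. -/
theorem lasso_support_recovery_of_sampleCov {m n : ℕ} (hn : 0 < n) (y e : Fin n → ℝ)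
    (H : Matrix (Fin n) (Fin m) ℝ) (p : ℝ) (β : Fin m → ℝ)
    (hy : ∀ i, y i = p + (H *ᵥ β) i + e i) (lam γ ℓ B : ℝ) (hlam : 0 < lam) (hγ : 0 < γ)
    (hℓ : ℓ = ((activeSet β).card : ℝ)) (hℓ1 : 1 ≤ ℓ)
    (hB : ∀ k ∈ activeSet β, B ≤ |β k|) (hB0 : 0 ≤ B)
    (hlamB : lam ≤ γ / (3 * Real.sqrt ℓ) * B)
    (hcoer : ∀ v : Fin m → ℝ, (∀ j ∉ activeSet β, v j = 0) →
      4 / 5 * γ * ∑ j, v j ^ 2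
        ≤ ∑ j, v j * ∑ k, sampleCov (fun i => H i j) (fun i => H i k) * v k)
    (hcross : ∀ j ∉ activeSet β, ∀ k ∈ activeSet β,
      |sampleCov (fun i => H i j) (fun i => H i k)| ≤ γ / (5 * ℓ))
    (hw : ∀ j, |sampleCov (fun i => H i j) e| ≤ lam / 2) :
    ∃ b : Fin m → ℝ, (∀ b', IsLassoCoef y H lam b' ↔ b' = b) ∧ activeSet b = activeSet β := by
  set S := activeSet β with hS
  set C : Fin m → Fin m → ℝ := fun j k => sampleCov (fun i => H i j) (fun i => H i k) with hC
  set w : Fin m → ℝ := fun j => sampleCov (fun i => H i j) e with hwdef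
  have hn' : (0 : ℝ) < n := by positivity
  have hmemS : ∀ j, j ∈ S ↔ β j ≠ 0 := fun j => by simp [hS, activeSet]
  obtain ⟨v, hv0, hv⟩ := exists_supported_solution S C (κ := 4 / 5 * γ) (by positivity) hcoer
    (fun j => w j - lam * SignType.sign (β j))
  -- size of the correction
  set N1 := ∑ j, |v j| with hN1
  set N2 := ∑ j, v j ^ 2 with hN2
  have hN1nn : 0 ≤ N1 := Finset.sum_nonneg fun j _ => abs_nonneg _
  have hN2nn : 0 ≤ N2 := Finset.sum_nonneg fun j _ => sq_nonneg _
  have hCS : N1 ^ 2 ≤ ℓ * N2 := by rw [hℓ]; exact sq_sum_abs_le_card_mul S v hv0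
  have hquad : 4 / 5 * γ * N2 ≤ 3 / 2 * lam * N1 := by
    refine (hcoer v hv0).trans ?_
    rw [hN1, Finset.mul_sum]
    refine Finset.sum_le_sum fun j _ => ?_
    by_cases hj : j ∈ S
    · rw [show ∑ k, sampleCov (fun i => H i j) (fun i => H i k) * v k = _ from hv j hj]
      have h1 : |w j - lam * SignType.sign (β j)| ≤ 3 / 2 * lam := by
        have h2 : |lam * SignType.sign (β j)| ≤ lam * 1 := by
          rw [abs_mul, abs_of_pos hlam]
          exact mul_le_mul_of_nonneg_left (abs_sign_le_one _) hlam.le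
        have := abs_sub (w j) (lam * SignType.sign (β j))
        have := hw j
        simp only [hwdef] at *
        linarith
      calc v j * (w j - lam * SignType.sign (β j))
          ≤ |v j| * |w j - lam * SignType.sign (β j)| := by rw [← abs_mul]; exact le_abs_self _
        _ ≤ |v j| * (3 / 2 * lam) := by gcongr
        _ = 3 / 2 * lam * |v j| := by ring
    · simp [hv0 j hj]
  -- Cauchy-Schwarz, `N1 ^ 2 ≤ ℓ * N2`, turns the energy estimate into an ℓ¹ bound; `15/8 = (3/2) /
  -- (4/5)`.
  have hγN1 : γ * N1 ≤ 15 / 8 * lam * ℓ := by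
    rcases hN1nn.eq_or_lt with h0 | h0
    · rw [← h0, mul_zero]; positivity
    · refine le_of_mul_le_mul_right ?_ h0
      nlinarith [mul_le_mul_of_nonneg_left hCS hγ.le,
        mul_le_mul_of_nonneg_left hquad (by linarith : (0 : ℝ) ≤ ℓ)]
  have hlamsq : 9 * ℓ * lam ^ 2 ≤ γ ^ 2 * B ^ 2 := by
    have hs : 0 < Real.sqrt ℓ := Real.sqrt_pos.2 (by linarith)
    have h1 : 3 * Real.sqrt ℓ * lam ≤ γ * B := by
      rw [div_mul_eq_mul_div, le_div_iff₀ (by positivity)] at hlamB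
      linarith
    have h2 := pow_le_pow_left₀ (by positivity) h1 2
    rw [mul_pow, mul_pow, mul_pow, Real.sq_sqrt (by linarith)] at h2
    linarith
  have hBpos : 0 < B := by
    rcases hB0.eq_or_lt with h0 | h0
    · rw [← h0, mul_zero] at hlamB; linarith
    · exact h0
  -- Here `N2 ≤ (15/8)² λ² ℓ / γ²`, and the upper bound on `λ` makes this at most `(5/8)² B²`.
  have hN2lt : N2 < B ^ 2 := by
    have h1 : γ ^ 2 * N2 ≤ (15 / 8) ^ 2 * lam ^ 2 * ℓ := by
      have h2 := mul_le_mul_of_nonneg_left hquad hγ.le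
      have h3 := mul_le_mul_of_nonneg_left hγN1 hlam.le
      nlinarith
    have h4 : γ ^ 2 * N2 < γ ^ 2 * B ^ 2 := by
      have : 0 < γ ^ 2 * B ^ 2 := by positivity
      nlinarith
    exact lt_of_mul_lt_mul_left h4 (sq_nonneg γ)
  have hvlt : ∀ j ∈ S, |v j| < |β j| := by
    intro j hj
    have h1 : v j ^ 2 ≤ N2 :=
      Finset.single_le_sum (f := fun j => v j ^ 2) (fun j _ => sq_nonneg _) (Finset.mem_univ j)
    have h2 : |v j| < B := abs_lt_of_sq_lt_sq (by linarith) hB0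
    exact h2.trans_le (hB j hj)
  -- the primal-dual pair
  set b : Fin m → ℝ := β + v with hb
  set a : ℝ := p + sampleMean e - sampleMean (H *ᵥ v) with ha
  set z : Fin m → ℝ := fun j => if j ∈ S then (SignType.sign (β j) : ℝ)
    else (w j - ∑ k, C j k * v k) / lam with hz
  have hres : ∀ i, y i - a - (H *ᵥ b) i
      = (e i - sampleMean e) - ((H *ᵥ v) i - sampleMean (H *ᵥ v)) := by
    intro i
    rw [hy, hb, Matrix.mulVec_add, ha, Pi.add_apply]
    ring
  have hoff : ∀ j ∉ S, |z j| < 1 := by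
    intro j hj
    simp only [hz, hj, if_false]
    rw [abs_div, abs_of_pos hlam, div_lt_one hlam]
    have h1 : |∑ k, C j k * v k| ≤ γ / (5 * ℓ) * N1 := by
      refine (Finset.abs_sum_le_sum_abs _ _).trans ?_
      rw [hN1, Finset.mul_sum]
      refine Finset.sum_le_sum fun k _ => ?_
      by_cases hk : k ∈ S
      · rw [abs_mul]
        exact mul_le_mul_of_nonneg_right (hcross j hj k hk) (abs_nonneg _)
      · simp [hv0 k hk]
    -- With the noise share `1/2`, the inactive multipliers stay below `1/2 + 3/8 = 7/8`.
    have h2 : γ / (5 * ℓ) * N1 ≤ 3 / 8 * lam := by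
      rw [div_mul_eq_mul_div, div_le_iff₀ (by positivity)]
      nlinarith
    have h3 := abs_sub (w j) (∑ k, C j k * v k)
    have h4 : |w j| ≤ lam / 2 := hw j
    linarith
  refine ⟨b, isLassoCoef_iff_eq_of_kkt y H lam hn hlam S a b z ?_ ?_ ?_ ?_ hoff ?_, ?_⟩
  · simp only [hres]
    rw [Finset.sum_sub_distrib, sum_sub_sampleMean hn, sum_sub_sampleMean hn, sub_zero]
  · intro j
    have h1 : ∑ i, H i j * (y i - a - (H *ᵥ b) i)
        = n * (w j - ∑ k, C j k * v k) := by
      rw [show ∑ k, C j k * v k = _ from (sampleCov_mulVec (fun i => H i j) H v).symm]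
      simp only [hres, hwdef, sampleCov]
      rw [← sub_div, mul_div_cancel₀ _ hn'.ne', ← Finset.sum_sub_distrib]
      exact Finset.sum_congr rfl fun i _ => by ring
    rw [h1]
    by_cases hj : j ∈ S
    · rw [hv j hj]; simp [hz, hj]
    · simp only [hz, hj, if_false]; field_simp
  · intro j
    by_cases hj : j ∈ S
    · simp only [hz, hj, if_true]; exact abs_sign_le_one _
    · exact (hoff j hj).le
  · intro j
    by_cases hj : j ∈ S
    · simp only [hz, hj, if_true, hb, Pi.add_apply]
      exact sign_mul_add_eq_abs (hvlt j hj)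
    · have : b j = 0 := by
        have := not_not.1 (mt (hmemS j).2 hj)
        simp [hb, hv0 j hj, this]
      simp [this]
  · intro c u hu hcu
    -- A constant sample has zero covariance with every column, so coercivity forces `u = 0`.
    have hconst : (H *ᵥ u) = fun _ => -c := by
      funext i; linarith [hcu i]
    have hz0 : ∀ j, ∑ k, C j k * u k = 0 := by
      intro j
      simp only [hC]
      rw [← sampleCov_mulVec, hconst]
      have : sampleMean (fun _ : Fin n => -c) = -c := by
        simp only [sampleMean, Finset.sum_const, Finset.card_univ, Fintype.card_fin, nsmul_eq_mul]
        field_simp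
      simp [sampleCov, this]
    have h1 := hcoer u hu
    have h0 : ∑ j, u j * ∑ k, C j k * u k = 0 :=
      Finset.sum_eq_zero fun j _ => by rw [hz0 j, mul_zero]
    rw [show ∑ j, u j * ∑ k, sampleCov (fun i => H i j) (fun i => H i k) * u k = 0 from h0] at h1
    have h2 : 0 ≤ ∑ j, u j ^ 2 := Finset.sum_nonneg fun j _ => sq_nonneg _
    have h3 : ∑ j, u j ^ 2 = 0 := by
      refine le_antisymm ?_ h2
      by_contra! h
      have : 0 < 4 / 5 * γ * ∑ j, u j ^ 2 := by positivity
      linarith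
    rw [Finset.sum_eq_zero_iff_of_nonneg fun i _ => sq_nonneg _] at h3
    funext j
    simpa using h3 j (Finset.mem_univ _)
  · ext j
    rw [hmemS]
    simp only [activeSet, Finset.mem_filter, Finset.mem_univ, true_and]
    constructor
    · intro h h0
      apply h
      have : j ∉ S := fun hj => (hmemS j).1 hj h0
      simp [hb, h0, hv0 j this]
    · intro h h0
      have h1 := hvlt j ((hmemS j).2 h)
      have : v j = -β j := by simp only [hb, Pi.add_apply] at h0; linarith
      rw [this, abs_neg] at h1
      exact lt_irrefl _ h1

/-! ### Smallest eigenvalue and Rayleigh quotients -/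

section Rayleigh

variable {ι : Type*} [Fintype ι] [DecidableEq ι]

/-- Every Rayleigh quotient of a symmetric matrix is at least `lambdaMin`. -/
theorem lambdaMin_mul_le_dotProduct_mulVec {A : Matrix ι ι ℝ} (hA : A.IsHermitian) (v : ι → ℝ) :
    lambdaMin A * (v ⬝ᵥ v) ≤ v ⬝ᵥ (A *ᵥ v) := by
  have hB : (A - lambdaMin A • (1 : Matrix ι ι ℝ)).IsHermitian := by
    refine hA.sub ?_
    simp [Matrix.IsHermitian]
  have hbdd : BddBelow {μ : ℝ | Module.End.HasEigenvalue (Matrix.toLin' A) μ} :=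
    (Module.End.finite_hasEigenvalue _).bddBelow
  have hpsd : (A - lambdaMin A • (1 : Matrix ι ι ℝ)).PosSemidef := by
    rw [hB.posSemidef_iff_eigenvalues_nonneg]
    intro i
    have h1 := hB.eigenvalues_mem_spectrum_real i
    rw [← Matrix.spectrum_toLin', ← Module.End.hasEigenvalue_iff_mem_spectrum] at h1
    obtain ⟨w, hw⟩ := h1.exists_hasEigenvector
    -- Eigenvalues of the shifted matrix are those of `A` minus `lambdaMin A`, hence nonnegative.
    have h2 : Module.End.HasEigenvalue (Matrix.toLin' A) (hB.eigenvalues i + lambdaMin A) := by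
      refine Module.End.hasEigenvalue_of_hasEigenvector (x := w)
        ⟨Module.End.mem_eigenspace_iff.2 ?_, hw.2⟩
      have h3 := hw.apply_eq_smul
      simp only [map_sub, map_smul, Matrix.toLin'_one, LinearMap.sub_apply, LinearMap.smul_apply,
        LinearMap.id_coe, id_eq] at h3
      rw [add_smul, ← h3, sub_add_cancel]
    have h4 : lambdaMin A ≤ hB.eigenvalues i + lambdaMin A := csInf_le hbdd h2
    simpa using h4
  have h := hpsd.dotProduct_mulVec_nonneg v
  simp only [star_trivial, Matrix.sub_mulVec, Matrix.smul_mulVec, Matrix.one_mulVec,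
    dotProduct_sub, dotProduct_smul, smul_eq_mul] at h
  linarith

/-- The infimum is attained on a finite non-empty spectrum, so testing on an eigenvector suffices.
For an empty index type the infimum would be the default value `0`. -/
theorem lambdaMin_pos [Nonempty ι] {A : Matrix ι ι ℝ} (hA : A.IsHermitian)
    (hpos : ∀ v : ι → ℝ, v ≠ 0 → 0 < v ⬝ᵥ (A *ᵥ v)) : 0 < lambdaMin A := by
  have hne : {μ : ℝ | Module.End.HasEigenvalue (Matrix.toLin' A) μ}.Nonempty := by
    refine ⟨hA.eigenvalues (Classical.arbitrary ι), ?_⟩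
    rw [Set.mem_ofPred_eq, Module.End.hasEigenvalue_iff_mem_spectrum, Matrix.spectrum_toLin']
    exact hA.eigenvalues_mem_spectrum_real _
  have hmem : Module.End.HasEigenvalue (Matrix.toLin' A) (lambdaMin A) :=
    hne.csInf_mem (Module.End.finite_hasEigenvalue _)
  obtain ⟨w, hw⟩ := hmem.exists_hasEigenvector
  have h1 := hpos w hw.2
  have h2 : A *ᵥ w = lambdaMin A • w := hw.apply_eq_smul
  rw [h2, dotProduct_smul, smul_eq_mul] at h1
  exact pos_of_mul_pos_left h1 (dotProduct_self_star_nonneg w)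

end Rayleigh

/-! ### Gram matrix and oracle residual -/

section Population

variable {𝒳 : Type*} [MeasurableSpace 𝒳] {P : Measure 𝒳} {m : ℕ} {h : Fin m → 𝒳 → ℝ}

theorem gram_isHermitian (S : Finset (Fin m)) : (gram P h S).IsHermitian := by
  ext j k
  simp [gram, mul_comm]

theorem dotProduct_gram_mulVec (hh : ∀ j, MemLp (h j) 2 P) (S : Finset (Fin m)) (v : S → ℝ) :
    v ⬝ᵥ (gram P h S *ᵥ v) = ‖∑ k, v k • (hh k).toLp (h k)‖ ^ 2 := by
  have h1 : ∀ j k : S, inner ℝ ((hh j).toLp (h j)) ((hh k).toLp (h k))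
      = gram P h S j k := by
    intro j k
    rw [L2.inner_def]
    refine integral_congr_ae ?_
    filter_upwards [(hh j).coeFn_toLp, (hh k).coeFn_toLp] with x hj hk
    rw [hj, hk]
    simp [mul_comm]
  rw [← real_inner_self_eq_norm_sq, sum_inner]
  simp only [dotProduct, Matrix.mulVec, inner_sum, inner_smul_left, inner_smul_right, h1]
  refine Finset.sum_congr rfl fun j _ => ?_
  rw [Finset.mul_sum]
  exact Finset.sum_congr rfl fun k _ => by simp; ring

theorem lambdaMin_gram_pos (hh : ∀ j, MemLp (h j) 2 P) {S : Finset (Fin m)} (hS : S.Nonempty)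
    (hind : LinearIndependent ℝ (fun k : S => (hh k).toLp (h k))) :
    0 < lambdaMin (gram P h S) := by
  have : Nonempty S := hS.to_subtype
  refine lambdaMin_pos (gram_isHermitian S) fun v hv => ?_
  rw [dotProduct_gram_mulVec hh]
  refine pow_pos (norm_pos_iff.2 fun h0 => hv ?_) 2
  funext k
  exact Fintype.linearIndependent_iff.1 hind v h0 k

theorem abs_le_supBound {𝒳 : Type*} {h : Fin m → 𝒳 → ℝ} (hbdd : ∃ M : ℝ, ∀ j x, |h j x| ≤ M) (j : Fin m) (x : 𝒳) :
    |h j x| ≤ supBound h := by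
  obtain ⟨M, hM⟩ := hbdd
  have : Nonempty 𝒳 := ⟨x⟩
  have h1 : BddAbove (Set.range fun x => |h j x|) := ⟨M, by rintro _ ⟨y, rfl⟩; exact hM j y⟩
  have h2 : BddAbove (Set.range fun j => ⨆ x, |h j x|) :=
    ⟨M, by rintro _ ⟨k, rfl⟩; exact ciSup_le fun y => hM k y⟩
  exact (le_ciSup h1 x).trans (le_ciSup h2 j)

/-- The residual of an oracle coefficient vector is orthogonal to the control functions. -/
theorem IsOracleCoef.integral_mul_residual_eq_zero {f : 𝒳 → ℝ} {β : Fin m → ℝ}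
    (hβ : IsOracleCoef P f h β) (hh : ∀ j, MemLp (h j) 2 P)
    (hε : MemLp (residual P f h β) 2 P) (j : Fin m) :
    ∫ x, h j x * residual P f h β x ∂P = 0 := by
  set ε := residual P f h β with hεdef
  set A := ∫ x, h j x * ε x ∂P with hA
  set B := ∫ x, h j x ^ 2 ∂P with hB
  have hBnn : 0 ≤ B := integral_nonneg fun x => sq_nonneg _
  have i1 : Integrable (fun x => ε x ^ 2) P := hε.integrable_sq
  have i2 : Integrable (fun x => h j x ^ 2) P := (hh j).integrable_sq
  have i3 : Integrable (fun x => h j x * ε x) P := (hh j).integrable_mul hε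
  have key : ∀ t : ℝ, 0 ≤ t ^ 2 * B - 2 * t * A := by
    intro t
    have h1 := hβ (β + Pi.single j t)
    have h2 : ∀ x, f x - (∫ y, f y ∂P) - linComb h (β + Pi.single j t) x
        = ε x - t * h j x := by
      intro x
      have : linComb h (β + Pi.single j t) x = linComb h β x + t * h j x := by
        simp only [linComb, Pi.add_apply, add_mul, Finset.sum_add_distrib, add_right_inj]
        rw [Finset.sum_eq_single j] <;> simp +contextual
      rw [this, hεdef, residual]
      ring
    simp only [h2] at h1
    have h3 : ∫ x, (ε x - t * h j x) ^ 2 ∂P = ∫ x, ε x ^ 2 ∂P + (t ^ 2 * B - 2 * t * A) := by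
      have : ∀ x, (ε x - t * h j x) ^ 2
          = ε x ^ 2 + (t ^ 2 * h j x ^ 2 - 2 * t * (h j x * ε x)) := fun x => by ring
      simp only [this]
      have i4 : Integrable (fun x => t ^ 2 * h j x ^ 2 - 2 * t * (h j x * ε x)) P :=
        (i2.const_mul _).sub (i3.const_mul _)
      rw [integral_add i1 i4, integral_sub (i2.const_mul _) (i3.const_mul _), integral_const_mul, integral_const_mul]
    rw [h3] at h1
    have h4 : ∫ x, (f x - (∫ y, f y ∂P) - linComb h β x) ^ 2 ∂P = ∫ x, ε x ^ 2 ∂P := rfl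
    linarith
  -- The optimal step would be `A / B`; the shift by one avoids a separate case `B = 0` and still
  -- gives a negative value when `A ≠ 0`.
  have h1 := key (A / (B + 1))
  have h2 : (A / (B + 1)) ^ 2 * B - 2 * (A / (B + 1)) * A
      = -(A ^ 2 * (B + 2) / (B + 1) ^ 2) := by
    field_simp
    ring
  rw [h2] at h1
  by_contra hne
  have : 0 < A ^ 2 * (B + 2) / (B + 1) ^ 2 := by positivity
  linarith

end Population

/-! ### Chernoff and Hoeffding bounds -/

section Tail

variable {𝒳 Ω : Type*} [MeasurableSpace 𝒳] [MeasurableSpace Ω] {P : Measure 𝒳} {μ : Measure Ω}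
  {n : ℕ} {X : Fin n → Ω → 𝒳}

theorem integrable_exp_mul_sum_of_aemeasurable {ι : Type*} [IsFiniteMeasure μ] {Y : ι → Ω → ℝ}
    {t : ℝ} (hindep : iIndepFun Y μ) (hY : ∀ i, AEMeasurable (Y i) μ) (s : Finset ι)
    (hint : ∀ i, Integrable (fun ω => Real.exp (t * Y i ω)) μ) :
    Integrable (fun ω => Real.exp (t * (∑ i ∈ s, Y i) ω)) μ := by
  classical
  induction s using Finset.induction_on with
  | empty => simp
  | insert i s hi ih =>
    rw [Finset.sum_insert hi]
    exact IndepFun.integrable_exp_mul_add (hindep.indepFun_finsetSum_of_notMem₀ hY hi).symm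
      (hint i) ih

/-- Chernoff's bound for an i.i.d. sample, from a bound on the moment generating function at a
single point. -/
theorem measureReal_sum_ge_le_exp [IsProbabilityMeasure μ] (hX : ∀ i, Measurable (X i))
    (hindep : iIndepFun X μ) (hlaw : ∀ i, Measure.map (X i) μ = P) {Z : 𝒳 → ℝ}
    (hZ : AEMeasurable Z P) {t c : ℝ} (ht : 0 ≤ t)
    (hint : Integrable (fun x => Real.exp (t * Z x)) P)
    (hmgf : ∫ x, Real.exp (t * Z x) ∂P ≤ Real.exp c) (s : ℝ) :
    μ.real {ω | s ≤ ∑ i, Z (X i ω)} ≤ Real.exp (n * c - t * s) := by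
  have hZ' : ∀ i, AEMeasurable Z (μ.map (X i)) := fun i => by rw [hlaw i]; exact hZ
  have hind : iIndepFun (fun i => Z ∘ X i) μ :=
    hindep.comp₀ (fun _ => Z) (fun i => (hX i).aemeasurable) hZ'
  have hmeas : ∀ i, AEMeasurable (Z ∘ X i) μ := fun i =>
    (hZ' i).comp_aemeasurable (hX i).aemeasurable
  have hint' : ∀ i, Integrable (fun ω => Real.exp (t * (Z ∘ X i) ω)) μ := fun i => by
    have : Integrable (fun x => Real.exp (t * Z x)) (μ.map (X i)) := by rw [hlaw i]; exact hint
    exact this.comp_measurable (hX i)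
  have hmgf' : ∀ i, mgf (Z ∘ X i) μ t ≤ Real.exp c := fun i => by
    have h1 : mgf (Z ∘ X i) μ t = ∫ x, Real.exp (t * Z x) ∂P := by
      rw [← hlaw i, integral_map (hX i).aemeasurable (by rw [hlaw i]; exact hint.1)]
      rfl
    rw [h1]; exact hmgf
  have h1 := measure_ge_le_exp_mul_mgf (μ := μ) (X := ∑ i, Z ∘ X i) s ht
    (integrable_exp_mul_sum_of_aemeasurable hind hmeas _ hint')
  rw [hind.mgf_sum₀ hmeas] at h1
  have h2 : ∏ i, mgf (Z ∘ X i) μ t ≤ Real.exp (n * c) := by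
    calc ∏ i, mgf (Z ∘ X i) μ t ≤ ∏ _i : Fin n, Real.exp c :=
          Finset.prod_le_prod (fun i _ => mgf_nonneg) fun i _ => hmgf' i
      _ = Real.exp (n * c) := by
          rw [Finset.prod_const, Finset.card_univ, Fintype.card_fin, Real.exp_nat_mul]
  have h3 : {ω | s ≤ ∑ i, Z (X i ω)} = {ω | s ≤ (∑ i, Z ∘ X i) ω} := by
    ext ω; simp [Finset.sum_apply]
  rw [h3]
  refine h1.trans ((mul_le_mul_of_nonneg_left h2 (Real.exp_nonneg _)).trans (le_of_eq ?_))
  rw [← Real.exp_add]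
  ring_nf

theorem measureReal_abs_sum_gt_le_exp [IsProbabilityMeasure μ] (hX : ∀ i, Measurable (X i))
    (hindep : iIndepFun X μ) (hlaw : ∀ i, Measure.map (X i) μ = P) {Z : 𝒳 → ℝ}
    (hZ : AEMeasurable Z P) {t c : ℝ} (ht : 0 ≤ t)
    (hint : Integrable (fun x => Real.exp (t * Z x)) P)
    (hmgf : ∫ x, Real.exp (t * Z x) ∂P ≤ Real.exp c)
    (hint' : Integrable (fun x => Real.exp (-t * Z x)) P)
    (hmgf' : ∫ x, Real.exp (-t * Z x) ∂P ≤ Real.exp c) (s : ℝ) :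
    μ.real {ω | s < |∑ i, Z (X i ω)|} ≤ 2 * Real.exp (n * c - t * s) := by
  have hneg : ∀ x, t * (-Z x) = -t * Z x := fun x => by ring
  have h1 := measureReal_sum_ge_le_exp hX hindep hlaw hZ ht hint hmgf s
  have h2 := measureReal_sum_ge_le_exp hX hindep hlaw (Z := fun x => -Z x) hZ.neg ht
    (by simpa only [hneg] using hint') (by simpa only [hneg] using hmgf') s
  have h3 : {ω | s < |∑ i, Z (X i ω)|}
      ⊆ {ω | s ≤ ∑ i, Z (X i ω)} ∪ {ω | s ≤ ∑ i, -Z (X i ω)} := by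
    intro ω hω
    rcases lt_abs.1 (show s < |∑ i, Z (X i ω)| from hω) with h | h
    · exact Or.inl h.le
    · right
      rw [Set.mem_ofPred_eq, Finset.sum_neg_distrib]
      exact h.le
  have h4 := (measureReal_mono h3 (measure_ne_top μ _)).trans (measureReal_union_le _ _)
  linarith

/-- Two-sided Hoeffding bound, at the deviation with failure probability `2 * exp (-L)`. -/
theorem HasSubgaussianMGF.measureReal_abs_sum_gt_le [IsProbabilityMeasure μ]
    (hX : ∀ i, Measurable (X i)) (hindep : iIndepFun X μ) (hlaw : ∀ i, Measure.map (X i) μ = P)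
    {Z : 𝒳 → ℝ} {v : ℝ≥0} (hZ : HasSubgaussianMGF Z (v ^ 2) P) (hv : 0 < v) (hn : 0 < n)
    {L : ℝ} (hL : 0 ≤ L) :
    μ.real {ω | n * (v * Real.sqrt (2 * L / n)) < |∑ i, Z (X i ω)|} ≤ 2 * Real.exp (-L) := by
  have hn' : (0 : ℝ) < n := by positivity
  have hv' : (0 : ℝ) < v := by exact_mod_cast hv
  set q := Real.sqrt (2 * L / n) with hq
  have hq2 : q ^ 2 = 2 * L / n := Real.sq_sqrt (by positivity)
  have hc : ∀ t : ℝ, t ^ 2 = (q / v) ^ 2 →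
      ∫ x, Real.exp (t * Z x) ∂P ≤ Real.exp (L / n) := by
    intro t ht
    refine (hZ.mgf_le t).trans (Real.exp_le_exp.2 (le_of_eq ?_))
    rw [ht, div_pow, hq2]
    push_cast
    field_simp
  -- At `t = q / v` the exponent is `n * (L / n) - n * q ^ 2 = L - 2 * L`.
  refine (measureReal_abs_sum_gt_le_exp hX hindep hlaw hZ.aemeasurable (t := q / v) (c := L / n)
    (by positivity) (hZ.integrable_exp_mul _) (hc _ rfl) (hZ.integrable_exp_mul _)
    (hc _ (by ring)) _).trans (le_of_eq ?_)
  congr 2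
  have : q / v * (n * (v * q)) = n * q ^ 2 := by field_simp
  rw [this, hq2]
  field_simp
  ring

end Tail

/-! ### Bounded times sub-Gaussian products -/

section Product

theorem exp_le_one_add_add_sq_mul_exp_abs (x : ℝ) :
    Real.exp x ≤ 1 + x + x ^ 2 * Real.exp |x| := by
  have h := Complex.norm_exp_sub_sum_le_norm_mul_exp (x : ℂ) 2
  simp only [Finset.sum_range_succ, Finset.sum_range_zero, pow_zero, Nat.factorial, pow_one,
    Nat.cast_one, div_one, zero_add, mul_one, Complex.norm_real, Real.norm_eq_abs, sq_abs] at h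
  rw [← Complex.ofReal_exp, ← Complex.ofReal_one, ← Complex.ofReal_add, ← Complex.ofReal_sub,
    Complex.norm_real, Real.norm_eq_abs] at h
  linarith [le_abs_self (Real.exp x - (1 + x))]

/-- Square `e * x ≤ exp x` at `x = 7u/16`, since `7/8 = 1 - 1/8`. It absorbs the quadratic factor of
the exponential remainder into `exp u`. -/
theorem sq_mul_exp_div_eight_le {u : ℝ} (hu : 0 ≤ u) :
    u ^ 2 * Real.exp (u / 8) ≤ 3 / 4 * Real.exp u := by
  have h1 : 7 * u / 16 * 2.7 ≤ Real.exp (7 * u / 16) := by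
    have h2 : 7 * u / 16 ≤ Real.exp (7 * u / 16 - 1) := by
      linarith [Real.add_one_le_exp (7 * u / 16 - 1)]
    calc 7 * u / 16 * 2.7 ≤ Real.exp (7 * u / 16 - 1) * Real.exp 1 := by
          have := Real.exp_one_gt_d9
          gcongr
          linarith
      _ = Real.exp (7 * u / 16) := by rw [← Real.exp_add]; ring_nf
  have h3 := pow_le_pow_left₀ (by positivity) h1 2
  have h4 : u ^ 2 ≤ 3 / 4 * Real.exp (7 * u / 16) ^ 2 := by nlinarith [sq_nonneg u]
  calc u ^ 2 * Real.exp (u / 8) ≤ 3 / 4 * Real.exp (7 * u / 16) ^ 2 * Real.exp (u / 8) := by gcongr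
    _ = 3 / 4 * Real.exp u := by
      rw [mul_assoc, sq, ← Real.exp_add, ← Real.exp_add]; ring_nf

theorem exp_half_le : Real.exp (1 / 2) ≤ 5 / 3 := by
  have h1 : Real.exp (1 / 2) ^ 2 = Real.exp 1 := by rw [sq, ← Real.exp_add]; norm_num
  have h2 := Real.exp_one_lt_d9
  refine le_of_sq_le_sq ?_ (by norm_num)
  rw [h1]; linarith

variable {𝒳 : Type*} [MeasurableSpace 𝒳] {P : Measure 𝒳} [IsProbabilityMeasure P]

/-- The product of a bounded function and a sub-Gaussian one has, if centered, a sub-Gaussian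
moment generating function near the origin. -/
theorem integral_exp_mul_mul_le {g ε : 𝒳 → ℝ} {U : ℝ} {τ : ℝ≥0} (hU : 0 < U) (hτ : 0 < τ)
    (hg : AEStronglyMeasurable g P) (hgU : ∀ x, |g x| ≤ U) (hε : HasSubgaussianMGF ε (τ ^ 2) P)
    (h0 : ∫ x, g x * ε x ∂P = 0) {t : ℝ} (ht : |t| * U * τ ≤ 1 / 8) :
    Integrable (fun x => Real.exp (t * (g x * ε x))) P ∧
      ∫ x, Real.exp (t * (g x * ε x)) ∂P ≤ Real.exp (3 * (t * U * τ) ^ 2) := by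
  have hτ' : (0 : ℝ) < τ := by exact_mod_cast hτ
  set q := |t| * U * τ with hq
  have hq0 : 0 ≤ q := by positivity
  -- An integrable majorant of `exp (|ε| / τ)`, with mean at most `2 * exp (1/2) ≤ 10/3`.
  set D : 𝒳 → ℝ := fun x => Real.exp (1 / τ * ε x) + Real.exp (-(1 / τ) * ε x) with hD
  have hDint : Integrable D P := (hε.integrable_exp_mul _).add (hε.integrable_exp_mul _)
  have hmgf : ∀ s : ℝ, s ^ 2 = (1 / τ) ^ 2 → ∫ x, Real.exp (s * ε x) ∂P ≤ 5 / 3 := by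
    intro s hs
    refine (hε.mgf_le s).trans (le_trans (le_of_eq ?_) exp_half_le)
    rw [hs]
    push_cast
    congr 1
    field_simp
  have hDle : ∫ x, D x ∂P ≤ 10 / 3 := by
    rw [hD, integral_add (hε.integrable_exp_mul _) (hε.integrable_exp_mul _)]
    linarith [hmgf (1 / τ) rfl, hmgf (-(1 / τ)) (by ring)]
  have hprod : Integrable (fun x => g x * ε x) P :=
    hε.integrable.bdd_mul hg (Filter.Eventually.of_forall hgU)
  have hpt : ∀ x, Real.exp (t * (g x * ε x))
      ≤ 1 + t * (g x * ε x) + q ^ 2 * (3 / 4) * D x := by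
    intro x
    set u := |ε x| / τ with hu
    have hu0 : 0 ≤ u := by positivity
    have h1 : |t * (g x * ε x)| ≤ q * u := by
      rw [abs_mul, abs_mul]
      calc |t| * (|g x| * |ε x|) ≤ |t| * (U * |ε x|) := by
            gcongr; exact hgU x
        _ = q * u := by rw [hq, hu]; field_simp
    have h2 : (t * (g x * ε x)) ^ 2 ≤ q ^ 2 * u ^ 2 := by
      rw [← sq_abs, ← mul_pow]; gcongr
    have h3 : Real.exp |t * (g x * ε x)| ≤ Real.exp (u / 8) := by
      refine Real.exp_le_exp.2 (h1.trans ?_)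
      nlinarith
    have h4 : Real.exp u ≤ D x := by
      have e1 : Real.exp u ≤ Real.exp (1 / τ * ε x) ∨ Real.exp u ≤ Real.exp (-(1 / τ) * ε x) := by
        rcases le_total 0 (ε x) with h | h
        · left; rw [hu, abs_of_nonneg h]; exact le_of_eq (by ring_nf)
        · right; rw [hu, abs_of_nonpos h]; exact le_of_eq (by ring_nf)
      have p1 := Real.exp_pos (1 / τ * ε x)
      have p2 := Real.exp_pos (-(1 / τ) * ε x)
      simp only [hD]
      rcases e1 with h | h <;> linarith
    have h5 : (t * (g x * ε x)) ^ 2 * Real.exp |t * (g x * ε x)| ≤ q ^ 2 * (3 / 4) * D x := by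
      calc (t * (g x * ε x)) ^ 2 * Real.exp |t * (g x * ε x)|
          ≤ q ^ 2 * u ^ 2 * Real.exp (u / 8) := by gcongr
        _ = q ^ 2 * (u ^ 2 * Real.exp (u / 8)) := by ring
        _ ≤ q ^ 2 * (3 / 4 * Real.exp u) :=
          mul_le_mul_of_nonneg_left (sq_mul_exp_div_eight_le hu0) (sq_nonneg q)
        _ ≤ q ^ 2 * (3 / 4 * D x) := by gcongr
        _ = q ^ 2 * (3 / 4) * D x := by ring
    linarith [exp_le_one_add_add_sq_mul_exp_abs (t * (g x * ε x))]
  have hR1 : Integrable (fun x => 1 + t * (g x * ε x)) P :=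
    (integrable_const 1).add (hprod.const_mul t)
  have hR : Integrable (fun x => 1 + t * (g x * ε x) + q ^ 2 * (3 / 4) * D x) P :=
    hR1.add (hDint.const_mul _)
  have hI : Integrable (fun x => Real.exp (t * (g x * ε x))) P := by
    refine hR.mono' ?_ (Filter.Eventually.of_forall fun x => ?_)
    · exact Real.continuous_exp.comp_aestronglyMeasurable (hprod.1.const_mul t)
    · rw [Real.norm_eq_abs, abs_of_pos (Real.exp_pos _)]; exact hpt x
  refine ⟨hI, ?_⟩
  have hq2 : (t * U * τ) ^ 2 = q ^ 2 := by
    rw [hq, mul_pow, mul_pow, mul_pow, mul_pow, sq_abs]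
  calc ∫ x, Real.exp (t * (g x * ε x)) ∂P
      ≤ ∫ x, (1 + t * (g x * ε x) + q ^ 2 * (3 / 4) * D x) ∂P := integral_mono hI hR hpt
    _ = 1 + q ^ 2 * (3 / 4) * ∫ x, D x ∂P := by
        rw [integral_add hR1 (hDint.const_mul _), integral_add (integrable_const 1)
          (hprod.const_mul t), integral_const_mul, integral_const_mul, h0]
        simp
    -- The constant is `3/4 * 10/3 = 5/2 ≤ 3`.
    _ ≤ 3 * q ^ 2 + 1 := by nlinarith [sq_nonneg q]
    _ ≤ Real.exp (3 * (t * U * τ) ^ 2) := by rw [hq2]; exact Real.add_one_le_exp _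

end Product

/-! ### From sample sums to sample covariances -/

/-- Support recovery for the LASSO with intercept, from deviation bounds on sample sums. -/
theorem lasso_support_recovery_of_sum_bounds {m n : ℕ} (hn : 0 < n) (y e : Fin n → ℝ)
    (H : Matrix (Fin n) (Fin m) ℝ) (p : ℝ) (β : Fin m → ℝ)
    (hy : ∀ i, y i = p + (H *ᵥ β) i + e i) (lam γ ℓ B : ℝ) (hγ : 0 < γ)
    (hℓ : ℓ = ((activeSet β).card : ℝ)) (hℓ1 : 1 ≤ ℓ)
    (hB : ∀ k ∈ activeSet β, B ≤ |β k|) (hB0 : 0 ≤ B)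
    (hlamB : lam ≤ γ / (3 * Real.sqrt ℓ) * B)
    (G : Fin m → Fin m → ℝ)
    (hG : ∀ v : Fin m → ℝ, (∀ j ∉ activeSet β, v j = 0) →
      γ * ∑ j, v j ^ 2 ≤ ∑ j, v j * ∑ k, G j k * v k)
    (hG0 : ∀ j ∉ activeSet β, ∀ k ∈ activeSet β, G j k = 0)
    {U τ q Q : ℝ} (hU : 0 < U) (hτ : 0 < τ) (hq : 0 < q) (hq8 : q ≤ 1 / 8)
    (hlam : 13 * U * τ * q ≤ lam)
    (hQ : U ^ 2 * Q + U ^ 2 * (2 * q ^ 2) ≤ γ / (5 * ℓ))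
    (hprod : ∀ j, ∀ k ∈ activeSet β, |∑ i, (H i j * H i k - G j k)| ≤ n * (U ^ 2 * Q))
    (hmean : ∀ j, |∑ i, H i j| ≤ n * (U * (Real.sqrt 2 * q)))
    (hnoise : ∀ j, |∑ i, H i j * e i| ≤ n * (4 * U * τ * q))
    (herr : |∑ i, e i| ≤ n * (τ * (Real.sqrt 2 * q))) :
    ∃ b : Fin m → ℝ, (∀ b', IsLassoCoef y H lam b' ↔ b' = b) ∧ activeSet b = activeSet β := by
  have hn' : (0 : ℝ) < n := by positivity
  have hs2 : Real.sqrt 2 * Real.sqrt 2 = 2 := Real.mul_self_sqrt (by norm_num)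
  have hmean_of : ∀ (x : Fin n → ℝ) (c : ℝ), |∑ i, x i| ≤ n * c → |sampleMean x| ≤ c := by
    intro x c hx
    rw [sampleMean, abs_div, abs_of_pos hn', div_le_iff₀ hn']
    linarith
  have hm : ∀ j, |sampleMean fun i => H i j| ≤ U * (Real.sqrt 2 * q) :=
    fun j => hmean_of _ _ (hmean j)
  have hcov : ∀ j, ∀ k ∈ activeSet β,
      |sampleCov (fun i => H i j) (fun i => H i k) - G j k| ≤ γ / (5 * ℓ) := by
    intro j k hk
    have h1 : |sampleMean (fun i => H i j * H i k) - G j k| ≤ U ^ 2 * Q := by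
      have h2 := hmean_of _ _ (hprod j k hk)
      have h3 : sampleMean (fun i => H i j * H i k - G j k)
          = sampleMean (fun i => H i j * H i k) - G j k := by
        simp only [sampleMean, Finset.sum_sub_distrib, Finset.sum_const, Finset.card_univ,
          Fintype.card_fin, nsmul_eq_mul]
        field_simp
      rwa [h3] at h2
    have h4 : |sampleMean (fun i => H i j) * sampleMean (fun i => H i k)|
        ≤ U ^ 2 * (2 * q ^ 2) := by
      rw [abs_mul]
      calc _ ≤ U * (Real.sqrt 2 * q) * (U * (Real.sqrt 2 * q)) :=
            mul_le_mul (hm j) (hm k) (abs_nonneg _) (by positivity)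
        _ = U ^ 2 * (Real.sqrt 2 * Real.sqrt 2 * q ^ 2) := by ring
        _ = U ^ 2 * (2 * q ^ 2) := by rw [hs2]
    rw [sampleCov_eq, sub_right_comm]
    exact (abs_sub _ _).trans (by linarith)
  have hlam0 : 0 < lam := lt_of_lt_of_le (by positivity) hlam
  refine lasso_support_recovery_of_sampleCov hn y e H p β hy lam γ ℓ B hlam0 hγ hℓ hℓ1 hB hB0
    hlamB ?_ ?_ ?_
  · intro v hv
    have h1 := hG v hv
    have h2 : ∑ j, v j * ∑ k, G j k * v k
        - ∑ j, v j * ∑ k, sampleCov (fun i => H i j) (fun i => H i k) * v k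
        ≤ γ / (5 * ℓ) * (∑ j, |v j|) ^ 2 := by
      rw [← Finset.sum_sub_distrib, sq, Finset.sum_mul_sum, Finset.mul_sum]
      refine Finset.sum_le_sum fun j _ => ?_
      rw [← mul_sub, ← Finset.sum_sub_distrib, Finset.mul_sum, Finset.mul_sum]
      refine Finset.sum_le_sum fun k _ => ?_
      by_cases hk : k ∈ activeSet β
      · rw [← sub_mul]
        refine (le_abs_self _).trans ?_
        rw [abs_mul, abs_mul, abs_sub_comm]
        calc |v j| * (|sampleCov (fun i => H i j) (fun i => H i k) - G j k| * |v k|)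
            ≤ |v j| * (γ / (5 * ℓ) * |v k|) := by
              have := hcov j k hk
              gcongr
          _ = γ / (5 * ℓ) * (|v j| * |v k|) := by ring
      · simp [hv k hk]
    have h3 := sq_sum_abs_le_card_mul (activeSet β) v hv
    rw [← hℓ] at h3
    have h4 : γ / (5 * ℓ) * (∑ j, |v j|) ^ 2 ≤ γ / 5 * ∑ j, v j ^ 2 := by
      refine (mul_le_mul_of_nonneg_left h3 (by positivity)).trans (le_of_eq ?_)
      have : ℓ ≠ 0 := by linarith
      field_simp
    linarith
  · intro j hj k hk
    have := hcov j k hk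
    rwa [hG0 j hj k hk, sub_zero] at this
  -- The product and mean terms give at most `(4 + 1/4) * U * τ * q`, below half of `13 * U * τ *
  -- q`.
  · intro j
    have h1 : |sampleMean (fun i => H i j * e i)| ≤ 4 * U * τ * q := hmean_of _ _ (hnoise j)
    have h2 : |sampleMean (fun i => H i j) * sampleMean e| ≤ U * τ * q / 4 := by
      rw [abs_mul]
      calc _ ≤ U * (Real.sqrt 2 * q) * (τ * (Real.sqrt 2 * q)) :=
            mul_le_mul (hm j) (hmean_of _ _ herr) (abs_nonneg _) (by positivity)
        _ = U * τ * q * (Real.sqrt 2 * Real.sqrt 2 * q) := by ring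
        _ ≤ U * τ * q * (1 / 4) := by rw [hs2]; gcongr; linarith
        _ = U * τ * q / 4 := by ring
    have h3 : 0 < U * τ * q := by positivity
    rw [sampleCov_eq]
    exact (abs_sub _ _).trans (by linarith)

/-! ### Bounds for bounded control variates, and sample size -/

section

variable {𝒳 : Type*} [MeasurableSpace 𝒳] {P : Measure 𝒳} {m : ℕ} {h : Fin m → 𝒳 → ℝ}

theorem lambdaMin_gram_mul_le (S : Finset (Fin m)) (v : Fin m → ℝ) (hv : ∀ j ∉ S, v j = 0) :
    lambdaMin (gram P h S) * ∑ j, v j ^ 2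
      ≤ ∑ j, v j * ∑ k, (∫ x, h j x * h k x ∂P) * v k := by
  have h1 := lambdaMin_mul_le_dotProduct_mulVec (gram_isHermitian (P := P) (h := h) S)
    (fun k : S => v k)
  have hsum : ∀ g : Fin m → ℝ, (∀ j ∉ S, g j = 0) → ∑ j, g j = ∑ j : S, g j := by
    intro g hg
    rw [Finset.sum_coe_sort S g]
    exact (Finset.sum_subset (Finset.subset_univ S) fun j _ hj => hg j hj).symm
  rw [hsum _ fun j hj => by simp [hv j hj], hsum _ fun j hj => by simp [hv j hj]]
  refine le_trans (le_of_eq ?_) (h1.trans (le_of_eq ?_))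
  · simp [dotProduct, sq]
  · simp only [dotProduct, Matrix.mulVec, gram, Matrix.of_apply]
    exact Finset.sum_congr rfl fun j _ => by
      rw [hsum (fun k => (∫ x, h j x * h k x ∂P) * v k) fun k hk => by simp [hv k hk]]

theorem lambdaMin_gram_le_sq [IsProbabilityMeasure P] {S : Finset (Fin m)} {k : Fin m} (hk : k ∈ S)
    {U : ℝ} (hU : ∀ x, |h k x| ≤ U) (hmem : MemLp (h k) 2 P) :
    lambdaMin (gram P h S) ≤ U ^ 2 := by
  have h1 := lambdaMin_gram_mul_le (P := P) (h := h) S (Pi.single k 1) fun j hj => by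
    rw [Pi.single_eq_of_ne]; rintro rfl; exact hj hk
  have h2 : ∑ j, (Pi.single k (1 : ℝ) : Fin m → ℝ) j ^ 2 = 1 := by
    rw [Finset.sum_eq_single k] <;> simp +contextual
  rw [h2, mul_one, Finset.sum_eq_single k (by simp +contextual) (by simp),
    Finset.sum_eq_single k (by simp +contextual) (by simp)] at h1
  simp only [Pi.single_eq_same, one_mul, mul_one, ← sq] at h1
  refine h1.trans ?_
  calc ∫ x, h k x ^ 2 ∂P ≤ ∫ _x, U ^ 2 ∂P :=
        integral_mono hmem.integrable_sq (integrable_const _) fun x => by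
          rw [← sq_abs]; exact pow_le_pow_left₀ (abs_nonneg _) (hU x) 2
    _ = U ^ 2 := by simp

theorem hasSubgaussianMGF_sub_integral_of_abs_le [IsProbabilityMeasure P] {g : 𝒳 → ℝ} {U : ℝ}
    (hU0 : 0 ≤ U) (hg : AEMeasurable g P) (hU : ∀ x, |g x| ≤ U) :
    HasSubgaussianMGF (fun x => g x - ∫ y, g y ∂P) (U.toNNReal ^ 2) P := by
  have h1 := hasSubgaussianMGF_of_mem_Icc (a := -U) (b := U) hg
    (Filter.Eventually.of_forall fun x => abs_le.1 (hU x))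
  have h2 : ‖U - -U‖₊ / 2 = U.toNNReal := by
    apply NNReal.coe_injective
    push_cast
    rw [Real.coe_toNNReal U hU0, Real.norm_eq_abs, abs_of_nonneg (by linarith)]
    ring
  rwa [h2] at h1

end

/-- The numerical consequences of the sample size condition. -/
theorem sample_size_bounds {ℓ U γ L L' N : ℝ} (hℓ : 1 ≤ ℓ) (hγ : 0 < γ) (hγU : γ ≤ U ^ 2)
    (hL' : 0 < L') (hLL : L' ≤ L) (hN : 70 * (ℓ * U ^ 2 / γ) ^ 2 * L ≤ N) :
    70 * L' ≤ N ∧ U ^ 2 * Real.sqrt (2 * L / N) + U ^ 2 * (2 * (L' / N)) ≤ γ / (5 * ℓ) := by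
  have hU2 : 0 < U ^ 2 := hγ.trans_le hγU
  have hU0 : U ≠ 0 := by rintro rfl; simp at hU2
  have hL : 0 < L := hL'.trans_le hLL
  have hr : ℓ ≤ ℓ * U ^ 2 / γ := by
    rw [le_div_iff₀ hγ]; gcongr
  have hr1 : 1 ≤ (ℓ * U ^ 2 / γ) ^ 2 := one_le_pow₀ (hℓ.trans hr)
  have h70 : 70 * L ≤ N := by nlinarith
  have hN0 : 0 < N := by linarith
  have hLN : L / N ≤ (γ / (ℓ * U ^ 2)) ^ 2 / 70 := by
    rw [div_le_iff₀ hN0]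
    have hpos : 0 < (γ / (ℓ * U ^ 2)) ^ 2 / 70 := by positivity
    have := mul_le_mul_of_nonneg_left hN hpos.le
    refine le_trans (le_of_eq ?_) this
    field_simp
  refine ⟨by linarith, ?_⟩
  -- The constant `70` is chosen for `√(2/70) + 2/70 < 17/100 + 1/35 < 1/5`.
  have h1 : U ^ 2 * Real.sqrt (2 * L / N) ≤ 17 / 100 * (γ / ℓ) := by
    have h2 : Real.sqrt (2 * L / N) ≤ 17 / 100 * (γ / (ℓ * U ^ 2)) := by
      refine Real.sqrt_le_iff.2 ⟨by positivity, ?_⟩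
      rw [mul_div_assoc, mul_pow]
      nlinarith [sq_nonneg (γ / (ℓ * U ^ 2))]
    calc U ^ 2 * Real.sqrt (2 * L / N) ≤ U ^ 2 * (17 / 100 * (γ / (ℓ * U ^ 2))) := by gcongr
      _ = 17 / 100 * (γ / ℓ) := by field_simp
  have h3 : U ^ 2 * (2 * (L' / N)) ≤ 1 / 35 * (γ / ℓ) := by
    have h4 : L' / N ≤ (γ / (ℓ * U ^ 2)) ^ 2 / 70 := (by gcongr : L' / N ≤ L / N).trans hLN
    have h5 : γ / (ℓ * U ^ 2) ≤ 1 := by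
      rw [div_le_one (by positivity)]; nlinarith
    have h6 : 0 < γ / (ℓ * U ^ 2) := by positivity
    calc U ^ 2 * (2 * (L' / N)) ≤ U ^ 2 * (2 * ((γ / (ℓ * U ^ 2)) ^ 2 / 70)) := by gcongr
      _ ≤ U ^ 2 * (2 * ((γ / (ℓ * U ^ 2)) / 70)) := by gcongr; nlinarith
      _ = 1 / 35 * (γ / ℓ) := by field_simp; norm_num
  have h7 : γ / (5 * ℓ) = 1 / 5 * (γ / ℓ) := by field_simp
  have h8 : 0 < γ / ℓ := by positivity
  rw [h7]
  linarith

end ControlVariates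

/-! ### The good event -/

theorem theorem3
    {𝒳 : Type*} [MeasurableSpace 𝒳] (P : Measure 𝒳) [IsProbabilityMeasure P]
    {m : ℕ} (f : 𝒳 → ℝ) (h : Fin m → 𝒳 → ℝ)
    (hf : MemLp f 2 P) (hh : ∀ j, MemLp (h j) 2 P)
    -- the control variates are centered
    (hcent : ∀ j, ∫ x, h j x ∂P = 0)
    -- oracle coefficient vector, with non-empty active set
    (β : Fin m → ℝ) (hβ : ControlVariates.IsOracleCoef P f h β)
    (hS : (ControlVariates.activeSet β).Nonempty)
    -- sub-Gaussian residuals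
    (τ : ℝ≥0) (hτ : 0 < τ)
    (hsub : HasSubgaussianMGF (ControlVariates.residual P f h β) (τ ^ 2) P)
    -- uniformly bounded control variates
    (hbdd : ∃ M : ℝ, ∀ j x, |h j x| ≤ M)
    -- the active control variates are linearly independent in `L²(P)`
    (hind : LinearIndependent ℝ
      (fun k : ControlVariates.activeSet β => (hh k).toLp (h k)))
    -- the inactive control variates are orthogonal to the active ones
    (horth : ∀ j ∉ ControlVariates.activeSet β, ∀ k ∈ ControlVariates.activeSet β,
      ∫ x, h j x * h k x ∂P = 0)
    -- names for the maximal sup-norm, the smallest eigenvalue and the sparsity level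
    (U γ ℓ : ℝ) (hU : U = ControlVariates.supBound h)
    (hγ : γ = ControlVariates.lambdaMin
      (ControlVariates.gram P h (ControlVariates.activeSet β)))
    (hℓ : ℓ = ((ControlVariates.activeSet β).card : ℝ))
    -- confidence level, sample size and regularization parameter
    (δ : ℝ) (hδ : δ ∈ Set.Ioo (0 : ℝ) 1)
    (n : ℕ) (hn : 70 * (ℓ * U ^ 2 / γ) ^ 2 * Real.log (10 * ℓ * m / δ) ≤ n)
    (lam : ℝ)
    (hlam_lower : 13 * U * Real.sqrt (Real.log (10 * m / δ)) * (τ / Real.sqrt n) ≤ lam)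
    (hlam_upper : lam ≤ γ / (3 * Real.sqrt ℓ) *
      (ControlVariates.activeSet β).inf' hS (fun k => |β k|))
    -- an independent sample of size `n` with common distribution `P`
    {Ω : Type*} [MeasurableSpace Ω] (μ : Measure Ω) [IsProbabilityMeasure μ]
    (X : Fin n → Ω → 𝒳) (hX : ∀ i, Measurable (X i))
    (hindep : iIndepFun X μ) (hlaw : ∀ i, Measure.map (X i) μ = P) :
    -- with probability at least `1 - δ`, there is exactly one LASSO coefficient vector
    -- and its support is the true active set
    ∃ E : Set Ω, MeasurableSet E ∧ ENNReal.ofReal (1 - δ) ≤ μ E ∧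
      ∀ ω ∈ E, ∃ b : Fin m → ℝ,
        (∀ b' : Fin m → ℝ,
          ControlVariates.IsLassoCoef (fun i => f (X i ω))
            (Matrix.of fun i j => h j (X i ω)) lam b' ↔ b' = b) ∧
        ControlVariates.activeSet b = ControlVariates.activeSet β := by
  set S := ControlVariates.activeSet β with hSdef
  set ε := ControlVariates.residual P f h β with hεdef
  obtain ⟨hδ0, hδ1⟩ := hδ
  obtain ⟨k₀, hk₀⟩ := id hS
  have hm1 : (1 : ℝ) ≤ m := by exact_mod_cast (Nat.pos_of_ne_zero (by rintro rfl; exact k₀.elim0))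
  have hℓ1 : 1 ≤ ℓ := by rw [hℓ]; exact_mod_cast hS.card_pos
  have hτ' : (0 : ℝ) < τ := by exact_mod_cast hτ
  have hUb : ∀ j x, |h j x| ≤ U := fun j x => hU ▸ ControlVariates.abs_le_supBound hbdd j x
  have hγ0 : 0 < γ := hγ ▸ ControlVariates.lambdaMin_gram_pos hh hS hind
  have hγU : γ ≤ U ^ 2 := hγ ▸ ControlVariates.lambdaMin_gram_le_sq hk₀ (hUb k₀) (hh k₀)
  obtain ⟨x₀⟩ := P.nonempty_of_neZero
  have hU0 : 0 < U := by
    refine ((abs_nonneg _).trans (hUb k₀ x₀)).lt_of_ne ?_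
    rintro rfl
    norm_num at hγU
    linarith
  set L' := Real.log (10 * m / δ) with hL'def
  set L := Real.log (10 * ℓ * m / δ) with hLdef
  have harg : 1 < 10 * m / δ := by rw [lt_div_iff₀ hδ0]; linarith
  have hL'0 : 0 < L' := Real.log_pos harg
  have hLL : L' ≤ L := by
    refine Real.log_le_log (by linarith) ?_
    gcongr
    linarith
  obtain ⟨h70, hQ⟩ := ControlVariates.sample_size_bounds hℓ1 hγ0 hγU hL'0 hLL hn
  have hn' : (0 : ℝ) < n := by linarith
  have hnpos : 0 < n := by exact_mod_cast hn'
  have hexpL' : Real.exp (-L') = δ / (10 * m) := by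
    rw [Real.exp_neg, Real.exp_log (by linarith), inv_div]
  have hexpL : Real.exp (-L) = δ / (10 * ℓ * m) := by
    rw [Real.exp_neg, Real.exp_log (by positivity), inv_div]
  set q := Real.sqrt (L' / n) with hqdef
  have hq2 : q ^ 2 = L' / n := Real.sq_sqrt (by positivity)
  have hq0 : 0 < q := Real.sqrt_pos.2 (by positivity)
  have hq8 : q ≤ 1 / 8 := by
    refine Real.sqrt_le_iff.2 ⟨by norm_num, ?_⟩
    rw [div_le_iff₀ hn']
    linarith
  have hs2q : Real.sqrt (2 * L' / n) = Real.sqrt 2 * q := by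
    rw [mul_div_assoc, Real.sqrt_mul (by norm_num)]
  have hlam : 13 * U * τ * q ≤ lam := by
    refine le_trans (le_of_eq ?_) hlam_lower
    rw [hqdef, Real.sqrt_div hL'0.le]
    ring
  have hhm : ∀ j, AEMeasurable (h j) P := fun j => (hh j).aestronglyMeasurable.aemeasurable
  have hεmem : MemLp ε 2 P := by exact_mod_cast hsub.memLp 2
  have horthε : ∀ j, ∫ x, h j x * ε x ∂P = 0 := fun j =>
    hβ.integral_mul_residual_eq_zero hh hεmem j
  set G : Fin m → Fin m → ℝ := fun j k => ∫ x, h j x * h k x ∂P with hGdef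
  set Q := Real.sqrt (2 * L / n) with hQdef
  let bprod : Fin m × Fin m → Set Ω := fun a =>
    {ω | n * (U ^ 2 * Q) < |∑ i, (h a.1 (X i ω) * h a.2 (X i ω) - G a.1 a.2)|}
  let bmean : Fin m → Set Ω := fun j =>
    {ω | n * (U * (Real.sqrt 2 * q)) < |∑ i, h j (X i ω)|}
  let bnoise : Fin m → Set Ω := fun j =>
    {ω | n * (4 * U * τ * q) < |∑ i, h j (X i ω) * ε (X i ω)|}
  let berr : Set Ω := {ω | n * (τ * (Real.sqrt 2 * q)) < |∑ i, ε (X i ω)|}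
  -- Only the `m * ℓ` pairs with second index in `S` enter the union, hence the logarithm of
  -- `10ℓm/δ`.
  have hbprod : ∀ a, μ.real (bprod a) ≤ 2 * Real.exp (-L) := by
    intro a
    have h1 := ControlVariates.hasSubgaussianMGF_sub_integral_of_abs_le (P := P)
      (g := fun x => h a.1 x * h a.2 x) (U := U ^ 2) (by positivity) ((hhm a.1).mul (hhm a.2))
      (fun x => by
        rw [abs_mul, sq]
        exact mul_le_mul (hUb _ x) (hUb _ x) (abs_nonneg _) hU0.le)
    have h2 := ControlVariates.HasSubgaussianMGF.measureReal_abs_sum_gt_le hX hindep hlaw h1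
      (Real.toNNReal_pos.2 (by positivity)) hnpos (hL'0.le.trans hLL)
    rwa [Real.coe_toNNReal _ (by positivity)] at h2
  have hbmean : ∀ j, μ.real (bmean j) ≤ 2 * Real.exp (-L') := by
    intro j
    have h1 := ControlVariates.hasSubgaussianMGF_sub_integral_of_abs_le (P := P)
      (g := h j) (U := U) hU0.le (hhm j) (hUb j)
    have h2 := ControlVariates.HasSubgaussianMGF.measureReal_abs_sum_gt_le hX hindep hlaw h1
      (Real.toNNReal_pos.2 hU0) hnpos hL'0.le
    simpa only [Real.coe_toNNReal _ hU0.le, hcent, sub_zero, hs2q] using h2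
  have hbnoise : ∀ j, μ.real (bnoise j) ≤ 2 * Real.exp (-L') := by
    intro j
    have ht : |q / (U * τ)| * U * τ = q := by
      rw [abs_of_pos (by positivity)]; field_simp
    have hc : ∀ t : ℝ, t = q / (U * τ) ∨ t = -(q / (U * τ)) → 3 * (t * U * τ) ^ 2 = 3 * q ^ 2 := by
      rintro t (rfl | rfl) <;> field_simp
    obtain ⟨i1, e1⟩ := ControlVariates.integral_exp_mul_mul_le hU0 hτ (hh j).aestronglyMeasurable
      (hUb j) hsub (horthε j) (t := q / (U * τ)) (by rw [ht]; exact hq8)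
    obtain ⟨i2, e2⟩ := ControlVariates.integral_exp_mul_mul_le hU0 hτ (hh j).aestronglyMeasurable
      (hUb j) hsub (horthε j) (t := -(q / (U * τ))) (by rw [abs_neg, ht]; exact hq8)
    rw [hc _ (Or.inl rfl)] at e1
    rw [hc _ (Or.inr rfl)] at e2
    refine (ControlVariates.measureReal_abs_sum_gt_le_exp hX hindep hlaw
      ((hhm j).mul hsub.aemeasurable) (by positivity) i1 e1 i2 e2 _).trans (le_of_eq ?_)
    congr 2
    -- The exponent is `3 * n * q ^ 2 - 4 * n * q ^ 2 = -L'`.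
    have h1 : q / (U * τ) * (n * (4 * U * τ * q)) = 4 * (n * q ^ 2) := by field_simp
    have h2 : n * q ^ 2 = L' := by rw [hq2]; field_simp
    rw [h1, h2, mul_left_comm, h2]
    ring
  have hberr : μ.real berr ≤ 2 * Real.exp (-L') := by
    have h2 := ControlVariates.HasSubgaussianMGF.measureReal_abs_sum_gt_le hX hindep hlaw hsub
      hτ hnpos hL'0.le
    rwa [hs2q] at h2
  set bad : Set Ω := (⋃ a ∈ (Finset.univ : Finset (Fin m)) ×ˢ S, bprod a) ∪
    ((⋃ j ∈ (Finset.univ : Finset (Fin m)), bmean j) ∪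
      ((⋃ j ∈ (Finset.univ : Finset (Fin m)), bnoise j) ∪ berr)) with hbad
  -- Each of the four families costs at most `δ/5`.
  have hbadle : μ.real bad ≤ δ := by
    have hp : μ.real (⋃ a ∈ (Finset.univ : Finset (Fin m)) ×ˢ S, bprod a) ≤ δ / 5 := by
      refine (measureReal_biUnion_finset_le _ _).trans
        ((Finset.sum_le_sum fun a _ => hbprod a).trans (le_of_eq ?_))
      rw [Finset.sum_const, Finset.card_product, Finset.card_univ, Fintype.card_fin, nsmul_eq_mul,
        Nat.cast_mul, ← hℓ, hexpL]
      field_simp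
      norm_num
    have hunion : ∀ s : Fin m → Set Ω, (∀ j, μ.real (s j) ≤ 2 * Real.exp (-L')) →
        μ.real (⋃ j ∈ (Finset.univ : Finset (Fin m)), s j) ≤ δ / 5 := by
      intro s hs
      refine (measureReal_biUnion_finset_le _ _).trans
        ((Finset.sum_le_sum fun a _ => hs a).trans (le_of_eq ?_))
      rw [Finset.sum_const, Finset.card_univ, Fintype.card_fin, nsmul_eq_mul, hexpL']
      field_simp
      norm_num
    have he : μ.real berr ≤ δ / 5 := by
      refine hberr.trans ?_
      rw [hexpL', mul_div_assoc', div_le_div_iff₀ (by positivity) (by norm_num)]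
      nlinarith
    have u1 := measureReal_union_le (μ := μ) (⋃ a ∈ (Finset.univ : Finset (Fin m)) ×ˢ S, bprod a)
      ((⋃ j ∈ (Finset.univ : Finset (Fin m)), bmean j) ∪
        ((⋃ j ∈ (Finset.univ : Finset (Fin m)), bnoise j) ∪ berr))
    have u2 := measureReal_union_le (μ := μ) (⋃ j ∈ (Finset.univ : Finset (Fin m)), bmean j)
      ((⋃ j ∈ (Finset.univ : Finset (Fin m)), bnoise j) ∪ berr)
    have u3 := measureReal_union_le (μ := μ) (⋃ j ∈ (Finset.univ : Finset (Fin m)), bnoise j) berr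
    have v2 := hunion bmean hbmean
    have v3 := hunion bnoise hbnoise
    linarith
  -- The control variates are only a.e. measurable, so `bad` is enlarged to a measurable hull of
  -- equal measure.
  refine ⟨(toMeasurable μ bad)ᶜ, (measurableSet_toMeasurable _ _).compl, ?_, ?_⟩
  · rw [prob_compl_eq_one_sub (measurableSet_toMeasurable _ _), measure_toMeasurable,
      ENNReal.ofReal_sub _ hδ0.le, ENNReal.ofReal_one]
    refine tsub_le_tsub_left ?_ _
    rw [← ofReal_measureReal (measure_ne_top μ bad)]
    exact ENNReal.ofReal_le_ofReal hbadle
  · intro ω hω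
    have hω' : ω ∉ bad := fun hb => hω (subset_toMeasurable μ bad hb)
    simp only [hbad, Set.mem_union, Set.mem_iUnion, not_or, not_exists, Finset.mem_univ,
      forall_true_left, Finset.mem_product, true_and] at hω'
    obtain ⟨g1, g2, g3, g4⟩ := hω'
    refine ControlVariates.lasso_support_recovery_of_sum_bounds hnpos _ (fun i => ε (X i ω)) _
      (∫ y, f y ∂P) β ?_ lam γ ℓ (S.inf' hS fun k => |β k|) hγ0 hℓ hℓ1
      (fun k hk => Finset.inf'_le _ hk) ?_ hlam_upper G ?_ horth hU0 hτ' hq0 hq8 hlam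
      (by rw [hq2]; exact hQ) ?_ ?_ ?_ ?_
    · intro i
      simp only [hεdef, ControlVariates.residual, ControlVariates.linComb, Matrix.mulVec,
        dotProduct, Matrix.of_apply, mul_comm (β _)]
      ring
    · exact Finset.le_inf' _ _ fun k _ => abs_nonneg _
    · intro v hv
      rw [hγ]
      exact ControlVariates.lambdaMin_gram_mul_le S v hv
    · intro j k hk
      exact not_lt.1 (g1 (j, k) hk)
    · intro j
      exact not_lt.1 (g2 j)
    · intro j
      exact not_lt.1 (g3 j)
    · exact not_lt.1 g4
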